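/- Let $0<q<1$, $\lambda>0$, $\eta\in\mathbb{R}$, and put $b=\lambda-i\eta$, $\eta_q=\eta\ln q$. Let $$d_{k+1}^{(b)}=\frac{(1-q^{k})(1-q^{2\lambda+k-1})}{4\,(1-q^{\lambda+k-1}\cos\eta_q)(1-q^{\lambda+k}\cos\eta_q)},\qquad k\ge 1 .$$ A parameter sequence of $\{d_{k+1}^{(b)}\}_{k\ge1}$ is a real sequence $\{g_{k+1}\}_{k\ge0}$ with $0\le g_1<1$, $0<g_{k+1}<1$ and $d_{k+1}^{(b)}=(1-g_k)\,g_{k+1}$ for all $k\ge1$; a sequence that has a parameter sequence is called a positive chain sequence, and its maximal parameter sequence is the parameter sequence that is termwise greater than or equal to every parameter sequence. Write $(a;q)_n=\prod_{j=0}^{n-1}(1-aq^j)$ and $${}_2\phi_1(a,\beta;c;q,z)=\sum_{n=0}^\infty\frac{(a;q)_n(\beta;q)_n}{(c;q)_n(q;q)_n}z^n .$$ Then $\{d_{k+1}^{(b)}\}_{k\ge1}$ is a positive chain sequence, it has a maximal parameter sequence $\{M_{k+1}^{(b)}\}_{k\ge0}$, and for every $k\ge0$ $$M_{k+1}^{(b)}=\frac12\,\frac{1-q^{\bar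 b+k}}{1-q^{\lambda+k}\cos\eta_q}\;\frac{{}_2\phi_1(q^{k},q^{-b+1};q^{\bar b+k};q,q^{b})}{{}_2\phi_1(q^{k+1},q^{-b+1};q^{\bar b+k+1};q,q^{b})},$$ where all the series converge absolutely and the denominators do not vanish. Moreover, $\lim_{k\to\infty}M_{k+1}^{(b)}=\frac12$. -/

import Mathlib

/-- The finite `q`-Pochhammer symbol `(a; q)_n = ∏_{j=0}^{n-1} (1 - a q^j)`. -/
noncomputable def qPoch (a q : ℂ) (n : ℕ) : ℂ :=
  ∏ j ∈ Finset.range n, (1 - a * q ^ j)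

/-- The `n`-th term of the basic hypergeometric series `₂φ₁(a, b; c; q, z)`. -/
noncomputable def phiTerm (a b c q z : ℂ) (n : ℕ) : ℂ :=
  qPoch a q n * qPoch b q n / (qPoch c q n * qPoch q q n) * z ^ n

/-- The basic hypergeometric series `₂φ₁(a, b; c; q, z)`. -/
noncomputable def phi21 (a b c q z : ℂ) : ℂ :=
  ∑' n : ℕ, phiTerm a b c q z n

/-- `g` (that is, `g_0, g_1, …`) is a parameter sequence of the sequence `a_1, a_2, …`:
`0 ≤ g_0 < 1`, `0 < g_n < 1` and `a_n = (1 - g_{n-1}) g_n` for `n ≥ 1`.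
The value `a 0` plays no role. -/
def IsParameterSequence (a g : ℕ → ℝ) : Prop :=
  (0 ≤ g 0 ∧ g 0 < 1) ∧
    (∀ n, 1 ≤ n → 0 < g n ∧ g n < 1) ∧
    ∀ n, 1 ≤ n → a n = (1 - g (n - 1)) * g n

/-- `a_1, a_2, …` is a positive chain sequence if it has a parameter sequence. -/
def IsPositiveChainSequence (a : ℕ → ℝ) : Prop :=
  ∃ g : ℕ → ℝ, IsParameterSequence a g

/-- `M` is the maximal parameter sequence of `a_1, a_2, …`: it is a parameter sequence
that dominates every other one termwise. -/
def IsMaximalParameterSequence (a M : ℕ → ℝ) : Prop :=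
  IsParameterSequence a M ∧ ∀ g : ℕ → ℝ, IsParameterSequence a g → ∀ n, g n ≤ M n

/-- `dSeq q lam eta k` is the coefficient `d_{k+1}^{(b)}` for `b = lam - i eta`,
with `eta_q = eta * log q`; the sequence of interest is `k ≥ 1`. -/
noncomputable def dSeq (q lam eta : ℝ) (k : ℕ) : ℝ :=
  (1 - q ^ k) * (1 - q ^ (2 * lam + (k : ℝ) - 1)) /
    (4 * (1 - q ^ (lam + (k : ℝ) - 1) * Real.cos (eta * Real.log q)) *
      (1 - q ^ (lam + (k : ℝ)) * Real.cos (eta * Real.log q)))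

/-- The `n`-th term of the series
`₂φ₁(q^k, q^{-b+1}; q^{conj b + k}; q, q^b)`. -/
noncomputable def phiBTerm (q : ℝ) (b : ℂ) (k n : ℕ) : ℂ :=
  phiTerm ((q : ℂ) ^ k) ((q : ℂ) ^ (-b + 1)) ((q : ℂ) ^ ((starRingEnd ℂ) b + (k : ℂ)))
    (q : ℂ) ((q : ℂ) ^ b) n

/-- The value `₂φ₁(q^k, q^{-b+1}; q^{conj b + k}; q, q^b)`. -/
noncomputable def phiB (q : ℝ) (b : ℂ) (k : ℕ) : ℂ :=
  phi21 ((q : ℂ) ^ k) ((q : ℂ) ^ (-b + 1)) ((q : ℂ) ^ ((starRingEnd ℂ) b + (k : ℂ)))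
    (q : ℂ) ((q : ℂ) ^ b)

/-!
Write `β = q ^ b` and `φ_k = ₂φ₁(q^k, q/β; conj β q^k; q, β)`. Heine's transformation turns `φ_k`,
multiplied by infinite products, into `₂φ₁(β, conj β; q; q, q^k)`, for `k ≥ 1` a series with
positive terms. The `q`-difference equation of the latter makes `G_k ∝ (conj β q^k; q)_∞ φ_k` a
positive solution of `2 (1 - q^k Re β) G_{k+1} = G_k + (1 - q^{k+1}) (1 - q^k |β|²) G_{k+2}`, so
that `M_k = G_k / (2 (1 - q^k Re β) G_{k+1})` is a parameter sequence. As `G_k` tends to `(q; q)_∞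
> 0`, the sum in Wall's criterion diverges, which makes `M` maximal, and `M_k` tends to `1/2`.
-/

open Filter Topology Finset ComplexConjugate ComplexOrder

/-- The infinite `q`-Pochhammer symbol `(a; q)_∞ = ∏_{j ≥ 0} (1 - a q^j)`; it is only meaningful
for `‖q‖ < 1`, where the product converges. -/
noncomputable def qPochInf (a q : ℂ) : ℂ := ∏' j : ℕ, (1 - a * q ^ j)

section PowerSeries

variable {u : ℕ → ℂ} {z : ℂ}

lemma summable_norm_mul_pow_of_isBounded (hu : Bornology.IsBounded (Set.range u)) (hz : ‖z‖ < 1) :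
    Summable fun n => ‖u n * z ^ n‖ := by
  obtain ⟨K, hK⟩ := hu.exists_norm_le
  refine .of_nonneg_of_le (fun _ => norm_nonneg _) (fun n => ?_)
    ((summable_geometric_of_lt_one (norm_nonneg z) hz).mul_left K)
  rw [norm_mul, norm_pow]
  gcongr
  exact hK _ ⟨n, rfl⟩

lemma tendsto_tsum_mul_pow_nhds_zero (hu : Bornology.IsBounded (Set.range u)) :
    Tendsto (fun z => ∑' n, u n * z ^ n) (𝓝 0) (𝓝 (u 0)) := by
  obtain ⟨K, hK⟩ := hu.exists_norm_le
  have hK0 : 0 ≤ K := (norm_nonneg _).trans (hK _ ⟨0, rfl⟩)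
  have hlim := tendsto_tsum_of_dominated_convergence (𝓕 := 𝓝 (0 : ℂ))
    (f := fun z n => u n * z ^ n) (g := fun n => u n * 0 ^ n)
    (summable_geometric_two.mul_left K)
    (fun n => ((continuous_id.pow n).tendsto 0).const_mul (u n)) (by
      filter_upwards [Metric.closedBall_mem_nhds (0 : ℂ) one_half_pos] with z hz n
      rw [mem_closedBall_zero_iff] at hz
      rw [norm_mul, norm_pow]
      gcongr
      exact hK _ ⟨n, rfl⟩)
  rwa [tsum_eq_single 0 fun n hn => by rw [zero_pow hn, mul_zero], pow_zero, mul_one] at hlim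

end PowerSeries

section QPochhammer

variable {a q : ℂ}

@[simp]
lemma qPoch_zero (a q : ℂ) : qPoch a q 0 = 1 := prod_range_zero _

lemma qPoch_succ (a q : ℂ) (n : ℕ) : qPoch a q (n + 1) = qPoch a q n * (1 - a * q ^ n) :=
  prod_range_succ ..

lemma norm_mul_pow_lt_one (hq : ‖q‖ ≤ 1) (ha : ‖a‖ < 1) (n : ℕ) : ‖a * q ^ n‖ < 1 := by
  rw [norm_mul, norm_pow]
  exact mul_lt_one_of_nonneg_of_lt_one_left (norm_nonneg _) ha (pow_le_one₀ (norm_nonneg _) hq)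

lemma one_sub_mul_pow_ne_zero (hq : ‖q‖ ≤ 1) (ha : ‖a‖ < 1) (n : ℕ) : 1 - a * q ^ n ≠ 0 := by
  intro h
  have hlt := norm_mul_pow_lt_one hq ha n
  rw [← sub_eq_zero.mp h, norm_one] at hlt
  exact hlt.false

lemma qPoch_ne_zero (ha : ∀ n : ℕ, 1 - a * q ^ n ≠ 0) (n : ℕ) : qPoch a q n ≠ 0 :=
  prod_ne_zero_iff.mpr fun j _ => ha j

lemma summable_norm_neg_mul_pow (hq : ‖q‖ < 1) (a : ℂ) :
    Summable fun j : ℕ => ‖-(a * q ^ j)‖ := by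
  simpa only [norm_neg, norm_mul, norm_pow] using
    (summable_geometric_of_lt_one (norm_nonneg q) hq).mul_left ‖a‖

lemma multipliable_one_sub_mul_pow (hq : ‖q‖ < 1) (a : ℂ) :
    Multipliable fun j : ℕ => 1 - a * q ^ j := by
  simpa only [sub_eq_add_neg] using
    multipliable_one_add_of_summable (summable_norm_neg_mul_pow hq a)

lemma tendsto_qPoch (hq : ‖q‖ < 1) (a : ℂ) : Tendsto (qPoch a q) atTop (𝓝 (qPochInf a q)) :=
  (multipliable_one_sub_mul_pow hq a).tendsto_prod_tprod_nat

lemma qPochInf_ne_zero (hq : ‖q‖ < 1) (ha : ∀ n : ℕ, 1 - a * q ^ n ≠ 0) : qPochInf a q ≠ 0 := by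
  simp only [sub_eq_add_neg] at ha
  simpa only [qPochInf, sub_eq_add_neg] using
    tprod_one_add_ne_zero_of_summable ha (summable_norm_neg_mul_pow hq a)

lemma qPoch_mul_qPochInf (hq : ‖q‖ < 1) (a : ℂ) (n : ℕ) :
    qPoch a q n * qPochInf (a * q ^ n) q = qPochInf a q := by
  have hshift (j : ℕ) : 1 - a * q ^ n * q ^ j = 1 - a * q ^ (j + n) := by ring
  simp only [qPoch, qPochInf, hshift]
  refine Multipliable.prod_mul_tprod_nat_mul' ?_
  simpa only [hshift] using multipliable_one_sub_mul_pow hq (a * q ^ n)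

lemma qPochInf_eq_mul (hq : ‖q‖ < 1) (a : ℂ) :
    qPochInf a q = (1 - a) * qPochInf (a * q) q := by
  simpa [qPoch_succ] using (qPoch_mul_qPochInf hq a 1).symm

lemma tendsto_qPochInf_mul_pow (hq : ‖q‖ < 1) (ha : ∀ n : ℕ, 1 - a * q ^ n ≠ 0) :
    Tendsto (fun n : ℕ => qPochInf (a * q ^ n) q) atTop (𝓝 1) := by
  have hlim : Tendsto (fun n => qPochInf a q / qPoch a q n) atTop
      (𝓝 (qPochInf a q / qPochInf a q)) :=
    tendsto_const_nhds.div (tendsto_qPoch hq a) (qPochInf_ne_zero hq ha)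
  rw [div_self (qPochInf_ne_zero hq ha)] at hlim
  refine hlim.congr fun n => ?_
  rw [← qPoch_mul_qPochInf hq a n, mul_div_cancel_left₀ _ (qPoch_ne_zero ha n)]

end QPochhammer

section QBinomial

variable {a q z : ℂ}

lemma isBounded_qBinomial_coeff (hq : ‖q‖ < 1) (a : ℂ) :
    Bornology.IsBounded (Set.range fun n => qPoch a q n / qPoch q q n) :=
  Metric.isBounded_range_of_tendsto _ ((tendsto_qPoch hq a).div (tendsto_qPoch hq q)
    (qPochInf_ne_zero hq (one_sub_mul_pow_ne_zero hq.le hq)))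

lemma summable_norm_qBinomial (hq : ‖q‖ < 1) (a : ℂ) (hz : ‖z‖ < 1) :
    Summable fun n => ‖qPoch a q n / qPoch q q n * z ^ n‖ :=
  summable_norm_mul_pow_of_isBounded (isBounded_qBinomial_coeff hq a) hz

lemma tsum_qBinomial_qDifference (hq : ‖q‖ < 1) (a : ℂ) (hz : ‖z‖ < 1) :
    (1 - z) * ∑' n, qPoch a q n / qPoch q q n * z ^ n =
      (1 - a * z) * ∑' n, qPoch a q n / qPoch q q n * (z * q) ^ n := by
  have hzq : ‖z * q‖ < 1 := by simpa only [pow_one] using norm_mul_pow_lt_one hq.le hz 1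
  have hs := (summable_norm_qBinomial hq a hz).of_norm
  have hsq := (summable_norm_qBinomial hq a hzq).of_norm
  set f := ∑' n, qPoch a q n / qPoch q q n * z ^ n
  set g := ∑' n, qPoch a q n / qPoch q q n * (z * q) ^ n
  have hcoeff (n : ℕ) : qPoch a q (n + 1) / qPoch q q (n + 1) * z ^ (n + 1) -
      qPoch a q (n + 1) / qPoch q q (n + 1) * (z * q) ^ (n + 1) =
      z * (qPoch a q n / qPoch q q n * z ^ n - a * (qPoch a q n / qPoch q q n * (z * q) ^ n)) := by
    have hden : 1 - q ^ (n + 1) ≠ 0 := by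
      simpa only [pow_succ'] using one_sub_mul_pow_ne_zero hq.le hq n
    have hQ := qPoch_ne_zero (one_sub_mul_pow_ne_zero hq.le hq) n
    rw [qPoch_succ, qPoch_succ, ← pow_succ']
    field_simp
    ring
  have hdiff : f - g = z * (f - a * g) := by
    rw [← hs.tsum_sub hsq, (hs.sub hsq).tsum_eq_zero_add, ← tsum_mul_left (a := a),
      ← hs.tsum_sub (hsq.mul_left a), ← tsum_mul_left]
    simp only [hcoeff, pow_zero, sub_self, zero_add]
  linear_combination hdiff

theorem qPochInf_mul_tsum_qBinomial (hq : ‖q‖ < 1) (a : ℂ) (hz : ‖z‖ < 1) :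
    qPochInf z q * ∑' n, qPoch a q n / qPoch q q n * z ^ n = qPochInf (a * z) q := by
  set f : ℂ → ℂ := fun z => ∑' n, qPoch a q n / qPoch q q n * z ^ n
  have hiter (N : ℕ) : qPoch z q N * f z = qPoch (a * z) q N * f (z * q ^ N) := by
    induction N with
    | zero => simp
    | succ N ih =>
      have hstep : (1 - z * q ^ N) * f (z * q ^ N) =
          (1 - a * (z * q ^ N)) * f (z * q ^ N * q) :=
        tsum_qBinomial_qDifference hq a (norm_mul_pow_lt_one hq.le hz N)
      rw [qPoch_succ, qPoch_succ, pow_succ, ← mul_assoc z]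
      linear_combination (1 - z * q ^ N) * ih + qPoch (a * z) q N * hstep
  have hzero : Tendsto (fun N : ℕ => z * q ^ N) atTop (𝓝 0) := by
    simpa using (tendsto_pow_atTop_nhds_zero_of_norm_lt_one hq).const_mul z
  have hf : Tendsto (fun N : ℕ => f (z * q ^ N)) atTop (𝓝 1) := by
    have hf0 : Tendsto f (𝓝 0) (𝓝 1) := by
      simpa only [qPoch_zero, div_one] using
        tendsto_tsum_mul_pow_nhds_zero (isBounded_qBinomial_coeff hq a)
    exact hf0.comp hzero
  have hleft := (tendsto_qPoch hq z).mul_const (f z)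
  have hright := (tendsto_qPoch hq (a * z)).mul hf
  rw [mul_one] at hright
  exact tendsto_nhds_unique hleft (hright.congr fun N => (hiter N).symm)

end QBinomial

section Heine

variable {a b c d q z : ℂ}

lemma tendsto_phi21_coeff (hq : ‖q‖ < 1) (a b : ℂ) (hc : ∀ n : ℕ, 1 - c * q ^ n ≠ 0) :
    Tendsto (fun n => qPoch a q n * qPoch b q n / (qPoch c q n * qPoch q q n)) atTop
      (𝓝 (qPochInf a q * qPochInf b q / (qPochInf c q * qPochInf q q))) :=
  ((tendsto_qPoch hq a).mul (tendsto_qPoch hq b)).div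
    ((tendsto_qPoch hq c).mul (tendsto_qPoch hq q))
    (mul_ne_zero (qPochInf_ne_zero hq hc)
      (qPochInf_ne_zero hq (one_sub_mul_pow_ne_zero hq.le hq)))

lemma summable_phiTerm (hq : ‖q‖ < 1) (a b : ℂ) (hc : ∀ n : ℕ, 1 - c * q ^ n ≠ 0)
    (hz : ‖z‖ < 1) : Summable (phiTerm a b c q z) :=
  (summable_norm_mul_pow_of_isBounded
    (Metric.isBounded_range_of_tendsto _ (tendsto_phi21_coeff hq a b hc)) hz).of_norm

lemma tendsto_phi21_nhds_zero (hq : ‖q‖ < 1) (a b : ℂ) (hc : ∀ n : ℕ, 1 - c * q ^ n ≠ 0) :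
    Tendsto (phi21 a b c q) (𝓝 0) (𝓝 1) := by
  have hlim := tendsto_tsum_mul_pow_nhds_zero
    (Metric.isBounded_range_of_tendsto _ (tendsto_phi21_coeff hq a b hc))
  simp only [qPoch_zero, mul_one, div_one] at hlim
  exact hlim

/-- Heine's idea: expand `(a; q)_n / (ad; q)_n` by the `q`-binomial theorem. -/
lemma qPochInf_mul_phi21_eq_tsum_tsum (hq : ‖q‖ < 1) (ha : ‖a‖ < 1) (b z : ℂ)
    (hd : ∀ n : ℕ, 1 - a * d * q ^ n ≠ 0) :
    qPochInf (a * d) q * phi21 a b (a * d) q z =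
      qPochInf a q * ∑' n, ∑' m, qPoch b q n / qPoch q q n * z ^ n *
        (qPoch d q m / qPoch q q m * (a * q ^ n) ^ m) := by
  rw [phi21, ← tsum_mul_left, ← tsum_mul_left]
  refine tsum_congr fun n => ?_
  have hbinom : qPoch a q n * qPochInf (a * d * q ^ n) q =
      qPochInf a q * ∑' m, qPoch d q m / qPoch q q m * (a * q ^ n) ^ m := by
    rw [← qPoch_mul_qPochInf hq a n, mul_assoc (qPoch a q n),
      qPochInf_mul_tsum_qBinomial hq d (norm_mul_pow_lt_one hq.le ha n)]
    ring_nf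
  have hdn := qPoch_ne_zero hd n
  rw [tsum_mul_left, mul_left_comm, ← hbinom, ← qPoch_mul_qPochInf hq (a * d) n, phiTerm]
  field_simp

/-- The lower parameters are written as multiples of `a` and `z` so that the two sides are exchanged
by `(a, b) ↔ (z, d)`. -/
theorem heine_transformation (hq : ‖q‖ < 1) (ha : ‖a‖ < 1) (hz : ‖z‖ < 1)
    (hd : ∀ n : ℕ, 1 - a * d * q ^ n ≠ 0) (hb : ∀ n : ℕ, 1 - z * b * q ^ n ≠ 0) :
    qPochInf z q * (qPochInf (a * d) q * phi21 a b (a * d) q z) =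
      qPochInf a q * (qPochInf (z * b) q * phi21 z d (z * b) q a) := by
  have hsum : Summable (Function.uncurry fun n m => qPoch b q n / qPoch q q n * z ^ n *
      (qPoch d q m / qPoch q q m * (a * q ^ n) ^ m)) := by
    refine .of_norm_bounded
      ((summable_norm_qBinomial hq b hz).mul_norm (summable_norm_qBinomial hq d ha)) ?_
    rintro ⟨n, m⟩
    simp only [Function.uncurry, norm_mul, norm_pow, mul_pow, ← mul_assoc]
    exact mul_le_of_le_one_right (by positivity)
      (pow_le_one₀ (by positivity) (pow_le_one₀ (norm_nonneg _) hq.le))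
  rw [qPochInf_mul_phi21_eq_tsum_tsum hq ha b z hd, qPochInf_mul_phi21_eq_tsum_tsum hq hz d a hb,
    mul_left_comm, ← hsum.tsum_comm]
  congr 2
  exact tsum_congr fun m => tsum_congr fun n => by ring

lemma sum_range_phiTerm_qDifference (hq : ‖q‖ < 1) (a b : ℂ)
    (hc : ∀ n : ℕ, 1 - c * q * q ^ n ≠ 0) (z : ℂ) (N : ℕ) :
    ∑ n ∈ range N, ((1 + c - (a + b) * z) * phiTerm a b (c * q) q (z * q) n -
        (c - a * b * z) * phiTerm a b (c * q) q (z * q * q) n) =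
      (1 - z) * ∑ n ∈ range N, phiTerm a b (c * q) q z n +
        phiTerm a b (c * q) q z N * ((1 - q ^ N) * (1 - c * q ^ N)) := by
  induction N with
  | zero => simp
  | succ N ih =>
    have hsucc : phiTerm a b (c * q) q z (N + 1) * ((1 - q ^ (N + 1)) * (1 - c * q ^ (N + 1))) =
        phiTerm a b (c * q) q z N * z * ((1 - a * q ^ N) * (1 - b * q ^ N)) := by
      have hcN : 1 - c * q ^ (N + 1) ≠ 0 := by simpa only [pow_succ', ← mul_assoc] using hc N
      have hqN : 1 - q ^ (N + 1) ≠ 0 := by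
        simpa only [pow_succ'] using one_sub_mul_pow_ne_zero hq.le hq N
      have hC := qPoch_ne_zero hc N
      have hQ := qPoch_ne_zero (one_sub_mul_pow_ne_zero hq.le hq) N
      simp only [phiTerm, qPoch_succ, mul_assoc c, ← pow_succ', pow_succ z]
      field_simp
    have hscale (w : ℂ) : phiTerm a b (c * q) q (w * q) N = phiTerm a b (c * q) q w N * q ^ N := by
      rw [phiTerm, phiTerm, mul_pow, mul_assoc]
    rw [sum_range_succ, ih, sum_range_succ, hsucc, hscale (z * q), hscale z]
    ring

/-- The remainder of the telescoping sum tends to `0` for `‖z‖ < 1`, but not for `z = 1`. -/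
lemma tendsto_phi21_qDifference (hq : ‖q‖ < 1) (a b : ℂ)
    (hc : ∀ n : ℕ, 1 - c * q * q ^ n ≠ 0) (hz : ‖z * q‖ < 1) :
    Tendsto (fun N => (1 - z) * ∑ n ∈ range N, phiTerm a b (c * q) q z n +
        phiTerm a b (c * q) q z N * ((1 - q ^ N) * (1 - c * q ^ N))) atTop
      (𝓝 ((1 + c - (a + b) * z) * phi21 a b (c * q) q (z * q) -
        (c - a * b * z) * phi21 a b (c * q) q (z * q * q))) := by
  have hzq : ‖z * q * q‖ < 1 := by simpa only [pow_one] using norm_mul_pow_lt_one hq.le hz 1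
  have hlim := (((summable_phiTerm hq a b hc hz).hasSum.mul_left (1 + c - (a + b) * z)).sub
    ((summable_phiTerm hq a b hc hzq).hasSum.mul_left (c - a * b * z))).tendsto_sum_nat
  exact hlim.congr (sum_range_phiTerm_qDifference hq a b hc z)

lemma tendsto_one_sub_pow_mul_one_sub (hq : ‖q‖ < 1) (c : ℂ) :
    Tendsto (fun N : ℕ => (1 - q ^ N) * (1 - c * q ^ N)) atTop (𝓝 1) := by
  have hpow := tendsto_pow_atTop_nhds_zero_of_norm_lt_one hq
  simpa using (hpow.const_sub 1).mul ((hpow.const_mul c).const_sub 1)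

theorem phi21_qDifference (hq : ‖q‖ < 1) (a b : ℂ) (hc : ∀ n : ℕ, 1 - c * q * q ^ n ≠ 0)
    (hz : ‖z‖ < 1) :
    (1 + c - (a + b) * z) * phi21 a b (c * q) q (z * q) -
      (c - a * b * z) * phi21 a b (c * q) q (z * q * q) = (1 - z) * phi21 a b (c * q) q z := by
  have hzq : ‖z * q‖ < 1 := by simpa only [pow_one] using norm_mul_pow_lt_one hq.le hz 1
  have hs := summable_phiTerm hq a b hc hz
  have hlim := (hs.hasSum.tendsto_sum_nat.const_mul (1 - z)).add
    (hs.tendsto_atTop_zero.mul (tendsto_one_sub_pow_mul_one_sub hq c))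
  rw [zero_mul, add_zero] at hlim
  exact tendsto_nhds_unique (tendsto_phi21_qDifference hq a b hc hzq) hlim

theorem phi21_qDifference_one (hq : ‖q‖ < 1) (a b : ℂ) (hc : ∀ n : ℕ, 1 - c * q * q ^ n ≠ 0) :
    qPochInf (c * q) q * qPochInf q q * ((1 + c - (a + b)) * phi21 a b (c * q) q q -
      (c - a * b) * phi21 a b (c * q) q (q * q)) = qPochInf a q * qPochInf b q := by
  have hqq := qPochInf_ne_zero hq (one_sub_mul_pow_ne_zero hq.le hq)
  have hcq := qPochInf_ne_zero hq hc
  have hbdry := tendsto_phi21_qDifference hq a b hc (z := 1) (by rwa [one_mul])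
  have hlim := (tendsto_phi21_coeff hq a b hc).mul (tendsto_one_sub_pow_mul_one_sub hq c)
  simp only [phiTerm, one_pow, mul_one, sub_self, zero_mul, zero_add, one_mul] at hbdry hlim
  rw [tendsto_nhds_unique hbdry hlim, mul_div_cancel₀ _ (mul_ne_zero hcq hqq)]

end Heine

section HeineSolution

/-- The solution `G` of `(2 - (β + γ) q^k) G_{k+1} = G_k + (1 - q^{k+1}) (1 - βγ q^k) G_{k+2}` with
`G_k / G_{k+1} = (1 - γ q^k) φ_k / φ_{k+1}`, where `φ_k = ₂φ₁(q^k, q/β; γ q^k; q, β)`. The infinite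
products are those of Heine's transformation. -/
noncomputable def heineSolution (q β γ : ℂ) (k : ℕ) : ℂ :=
  qPochInf β q * (qPochInf (γ * q ^ k) q * phi21 (q ^ k) (q / β) (γ * q ^ k) q β)

variable {q β γ : ℂ}

lemma phi21_one (b c q z : ℂ) : phi21 1 b c q z = 1 := by
  have hterm (n : ℕ) (hn : n ≠ 0) : phiTerm 1 b c q z n = 0 := by
    have hzero : qPoch 1 q n = 0 :=
      prod_eq_zero (mem_range.mpr (Nat.pos_of_ne_zero hn)) (by rw [pow_zero, mul_one, sub_self])
    rw [phiTerm, hzero, zero_mul, zero_div, zero_mul]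
  rw [phi21, tsum_eq_single 0 hterm]
  simp [phiTerm]

lemma heineSolution_zero (q β γ : ℂ) : heineSolution q β γ 0 = qPochInf β q * qPochInf γ q := by
  rw [heineSolution, pow_zero, mul_one, phi21_one, mul_one]

lemma heineSolution_succ (hq : ‖q‖ < 1) (hβ0 : β ≠ 0) (hβ : ‖β‖ < 1)
    (hγ : ∀ n : ℕ, 1 - γ * q ^ n ≠ 0) (k : ℕ) :
    heineSolution q β γ (k + 1) =
      qPochInf (q ^ (k + 1)) q * (qPochInf q q * phi21 β γ q q (q ^ (k + 1))) := by
  have hcancel : β * (q / β) = q := mul_div_cancel₀ q hβ0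
  have hd (n : ℕ) : 1 - q ^ (k + 1) * γ * q ^ n ≠ 0 := by
    convert hγ (k + 1 + n) using 2
    ring
  have heine := heine_transformation (b := q / β) (d := γ) hq
    (by rw [pow_succ']; exact norm_mul_pow_lt_one hq.le hq k) hβ hd
    (by rw [hcancel]; exact one_sub_mul_pow_ne_zero hq.le hq)
  rwa [hcancel, mul_comm (q ^ (k + 1)) γ] at heine

lemma heineSolution_recurrence (hq : ‖q‖ < 1) (hβ0 : β ≠ 0) (hβ : ‖β‖ < 1)
    (hγ : ∀ n : ℕ, 1 - γ * q ^ n ≠ 0) (k : ℕ) :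
    (2 - (β + γ) * q ^ k) * heineSolution q β γ (k + 1) =
      heineSolution q β γ k +
        (1 - q ^ (k + 1)) * (1 - β * γ * q ^ k) * heineSolution q β γ (k + 2) := by
  have hc (n : ℕ) : 1 - 1 * q * q ^ n ≠ 0 := by
    rw [one_mul]; exact one_sub_mul_pow_ne_zero hq.le hq n
  have hsucc := heineSolution_succ hq hβ0 hβ hγ
  have hshift (j : ℕ) : qPochInf (q ^ j) q = (1 - q ^ j) * qPochInf (q ^ (j + 1)) q := by
    rw [pow_succ]; exact qPochInf_eq_mul hq _
  rw [hsucc, hsucc (k + 1), hshift (k + 1)]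
  cases k with
  | zero =>
    have hq1 := hshift 1
    have hstep := phi21_qDifference_one hq β γ hc
    simp only [one_mul, ← sq] at hstep
    rw [pow_one] at hq1
    rw [heineSolution_zero, ← hstep, hq1]
    simp only [zero_add, pow_zero, pow_one]
    ring
  | succ k =>
    have hstep := phi21_qDifference (z := q ^ (k + 1)) hq β γ hc
      (by rw [pow_succ']; exact norm_mul_pow_lt_one hq.le hq k)
    simp only [one_mul, ← pow_succ] at hstep
    rw [hsucc, hshift (k + 1), hshift (k + 1 + 1)]
    linear_combination (1 - q ^ (k + 1 + 1)) * qPochInf (q ^ (k + 1 + 1 + 1)) q * qPochInf q q *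
      hstep

lemma tendsto_heineSolution (hq : ‖q‖ < 1) (hβ0 : β ≠ 0) (hβ : ‖β‖ < 1)
    (hγ : ∀ n : ℕ, 1 - γ * q ^ n ≠ 0) :
    Tendsto (heineSolution q β γ) atTop (𝓝 (qPochInf q q)) := by
  have hqn := one_sub_mul_pow_ne_zero hq.le hq
  have hpow : Tendsto (fun k : ℕ => q ^ (k + 1)) atTop (𝓝 0) :=
    (tendsto_pow_atTop_nhds_zero_of_norm_lt_one hq).comp (tendsto_add_atTop_nat 1)
  have hprod : Tendsto (fun k : ℕ => qPochInf (q ^ (k + 1)) q) atTop (𝓝 1) := by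
    simpa only [pow_succ'] using tendsto_qPochInf_mul_pow hq hqn
  have hlim := hprod.mul (((tendsto_phi21_nhds_zero hq β γ hqn).comp hpow).const_mul (qPochInf q q))
  rw [one_mul, mul_one] at hlim
  rw [← tendsto_add_atTop_iff_nat 1]
  exact hlim.congr fun k => (heineSolution_succ hq hβ0 hβ hγ k).symm

lemma heineSolution_div_succ (hq : ‖q‖ < 1) (hβ : ‖β‖ < 1) (hγ : ∀ n : ℕ, 1 - γ * q ^ n ≠ 0)
    (k : ℕ) :
    heineSolution q β γ k / heineSolution q β γ (k + 1) =
      (1 - γ * q ^ k) * (phi21 (q ^ k) (q / β) (γ * q ^ k) q β /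
        phi21 (q ^ (k + 1)) (q / β) (γ * q ^ (k + 1)) q β) := by
  have hPβ := qPochInf_ne_zero hq (one_sub_mul_pow_ne_zero hq.le hβ)
  have hPγ : qPochInf (γ * q ^ (k + 1)) q ≠ 0 := by
    refine qPochInf_ne_zero hq fun n => ?_
    rw [mul_assoc, ← pow_add]
    exact hγ _
  rw [heineSolution, heineSolution, qPochInf_eq_mul hq (γ * q ^ k), mul_assoc γ, ← pow_succ,
    mul_div_mul_left _ _ hPβ, mul_right_comm, mul_comm, mul_div_mul_left _ _ hPγ, mul_div_assoc]

end HeineSolution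

section Positivity

variable {q x : ℝ} {β : ℂ}

lemma qPoch_conj (a : ℂ) (q : ℝ) (n : ℕ) : qPoch (conj a) q n = conj (qPoch a q n) := by
  simp [qPoch]

lemma qPochInf_conj (hq : ‖(q : ℂ)‖ < 1) (a : ℂ) : qPochInf (conj a) q = conj (qPochInf a q) := by
  rw [qPochInf, qPochInf, (multipliable_one_sub_mul_pow hq a).map_tprod _ Complex.continuous_conj]
  simp

lemma qPochInf_ofReal_pos (hq0 : 0 ≤ q) (hq1 : q < 1) (hx0 : 0 ≤ x) (hx1 : x < 1) :
    0 < qPochInf x q := by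
  have hq : ‖(q : ℂ)‖ < 1 := by rwa [Complex.norm_of_nonneg hq0]
  have hx : ‖(x : ℂ)‖ < 1 := by rwa [Complex.norm_of_nonneg hx0]
  have hfactor (j : ℕ) : (0 : ℂ) ≤ 1 - x * q ^ j := by
    have hle : x * q ^ j ≤ 1 := mul_le_one₀ hx1.le (pow_nonneg hq0 j) (pow_le_one₀ hq0 hq1.le)
    exact_mod_cast sub_nonneg.mpr hle
  have hne := qPochInf_ne_zero hq (one_sub_mul_pow_ne_zero hq.le hx)
  exact (tprod_nonneg hfactor).lt_of_ne hne.symm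

lemma phi21_conj_pos (hq0 : 0 ≤ q) (hq1 : q < 1) (β : ℂ) (hx0 : 0 ≤ x) (hx1 : x < 1) :
    0 < phi21 β (conj β) q q x := by
  have hq : ‖(q : ℂ)‖ < 1 := by rwa [Complex.norm_of_nonneg hq0]
  have hx : ‖(x : ℂ)‖ < 1 := by rwa [Complex.norm_of_nonneg hx0]
  have hterm (n : ℕ) : 0 ≤ phiTerm β (conj β) q q x n := by
    have hself : qPoch (q : ℂ) q n = conj (qPoch (q : ℂ) q n) := by
      rw [← qPoch_conj, Complex.conj_ofReal]
    have hsq : phiTerm β (conj β) q q x n = qPoch β q n / qPoch q q n *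
        conj (qPoch β q n / qPoch q q n) * x ^ n := by
      rw [phiTerm, map_div₀, ← hself, qPoch_conj, div_mul_div_comm]
    rw [hsq]
    exact mul_nonneg (mul_star_self_nonneg _) (pow_nonneg (Complex.zero_le_real.mpr hx0) n)
  exact (summable_phiTerm hq _ _ (one_sub_mul_pow_ne_zero hq.le hq) hx).tsum_pos hterm 0
    (by simp [phiTerm])

lemma heineSolution_conj_pos (hq0 : 0 ≤ q) (hq1 : q < 1) (hβ0 : β ≠ 0) (hβ : ‖β‖ < 1) (k : ℕ) :
    0 < heineSolution q β (conj β) k := by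
  have hq : ‖(q : ℂ)‖ < 1 := by rwa [Complex.norm_of_nonneg hq0]
  have hconj : ‖conj β‖ < 1 := by rwa [RCLike.norm_conj]
  cases k with
  | zero =>
    have hP := qPochInf_ne_zero hq (one_sub_mul_pow_ne_zero hq.le hβ)
    rw [heineSolution_zero, qPochInf_conj hq]
    exact (mul_star_self_nonneg _).lt_of_ne (mul_ne_zero hP (star_ne_zero.mpr hP)).symm
  | succ k =>
    have hpow0 : 0 ≤ q ^ (k + 1) := pow_nonneg hq0 _
    have hpow1 : q ^ (k + 1) < 1 := pow_lt_one₀ hq0 hq1 k.succ_ne_zero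
    rw [heineSolution_succ hq hβ0 hβ (one_sub_mul_pow_ne_zero hq.le hconj), ← Complex.ofReal_pow]
    exact mul_pos (qPochInf_ofReal_pos hq0 hq1 hpow0 hpow1)
      (mul_pos (qPochInf_ofReal_pos hq0 hq1 hq0 hq1)
        (phi21_conj_pos hq0 hq1 β hpow0 hpow1))

end Positivity

section ChainSequence

variable {a g M : ℕ → ℝ}

lemma IsMaximalParameterSequence.unique {M N : ℕ → ℝ} (hM : IsMaximalParameterSequence a M)
    (hN : IsMaximalParameterSequence a N) : M = N :=
  funext fun n => le_antisymm (hN.2 M hM.1 n) (hM.2 N hN.1 n)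

lemma IsParameterSequence.lt_one (hg : IsParameterSequence a g) (k : ℕ) : g k < 1 := by
  rcases k with _ | k
  exacts [hg.1.2, (hg.2.1 _ k.succ_pos).2]

lemma IsParameterSequence.succ_pos (hg : IsParameterSequence a g) (k : ℕ) : 0 < g (k + 1) :=
  (hg.2.1 _ k.succ_pos).1

lemma IsParameterSequence.one_sub_mul_sub (hg : IsParameterSequence a g)
    (hM : IsParameterSequence a M) (k : ℕ) :
    (1 - g k) * (g (k + 1) - M (k + 1)) = (g k - M k) * M (k + 1) := by
  have hgk := hg.2.2 (k + 1) k.succ_pos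
  have hMk := hM.2.2 (k + 1) k.succ_pos
  rw [Nat.add_sub_cancel] at hgk hMk
  linear_combination hMk - hgk

lemma IsParameterSequence.lt_iff_lt_zero (hg : IsParameterSequence a g)
    (hM : IsParameterSequence a M) (n : ℕ) : M n < g n ↔ M 0 < g 0 := by
  induction n with
  | zero => rfl
  | succ k ih =>
    rw [← ih, ← sub_pos, ← sub_pos (a := g k),
      ← mul_pos_iff_of_pos_left (sub_pos.mpr (hg.lt_one k)), hg.one_sub_mul_sub hM,
      mul_pos_iff_of_pos_right (hM.succ_pos k)]

/-- The sufficiency half of Wall's criterion. If `g` exceeds `M`, then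
`y_n = (1 - M_n) / (g_n - M_n)` is positive and the partial sums telescope to `y_0 - R_n y_n`,
`R_n` being the `n`-th term. -/
theorem IsParameterSequence.isMaximal_of_not_summable (hM : IsParameterSequence a M)
    (hdiv : ¬ Summable fun n => ∏ k ∈ range n, M (k + 1) / (1 - M (k + 1))) :
    IsMaximalParameterSequence a M := by
  refine ⟨hM, fun g hg m => ?_⟩
  by_contra! hlt
  have hδ (n : ℕ) : 0 < g n - M n :=
    sub_pos.mpr ((hg.lt_iff_lt_zero hM n).mpr ((hg.lt_iff_lt_zero hM m).mp hlt))
  set R : ℕ → ℝ := fun n => ∏ k ∈ range n, M (k + 1) / (1 - M (k + 1))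
  set y : ℕ → ℝ := fun n => (1 - M n) / (g n - M n)
  have hR (n : ℕ) : 0 ≤ R n := prod_nonneg fun k _ =>
    div_nonneg (hM.succ_pos k).le (sub_pos.mpr (hM.lt_one _)).le
  have hy (n : ℕ) : 0 ≤ y n := div_nonneg (sub_pos.mpr (hM.lt_one n)).le (hδ n).le
  have hstep (n : ℕ) : M (n + 1) / (1 - M (n + 1)) * y (n + 1) = y n - 1 := by
    have hMn := (sub_pos.mpr (hM.lt_one (n + 1))).ne'
    rw [div_mul_div_comm, mul_comm (1 - M (n + 1)), mul_div_mul_right _ _ hMn,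
      div_sub_one (hδ n).ne', div_eq_div_iff (hδ _).ne' (hδ n).ne']
    linear_combination -hg.one_sub_mul_sub hM n
  have hsum (n : ℕ) : ∑ k ∈ range n, R k = y 0 - R n * y n := by
    induction n with
    | zero => simp [R]
    | succ n ih =>
      have hRn : R (n + 1) = R n * (M (n + 1) / (1 - M (n + 1))) := prod_range_succ ..
      rw [sum_range_succ, ih, hRn]
      linear_combination R n * hstep n
  exact hdiv (summable_of_sum_range_le (c := y 0) hR fun n =>
    (hsum n).trans_le (sub_le_self _ (mul_nonneg (hR n) (hy n))))

variable {c e F : ℕ → ℝ}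

lemma isParameterSequence_of_recurrence (he : ∀ k, 0 < e k) (hF : ∀ k, 0 < F k)
    (hrec : ∀ k, c k * F (k + 1) = F k + e k * F (k + 2))
    (ha : ∀ k, a (k + 1) = e k / (c k * c (k + 1))) :
    IsParameterSequence a fun k => F k / (c k * F (k + 1)) := by
  have hden (k : ℕ) : 0 < c k * F (k + 1) :=
    hrec k ▸ add_pos (hF k) (mul_pos (he k) (hF _))
  have hpos (k : ℕ) : 0 < F k / (c k * F (k + 1)) := div_pos (hF k) (hden k)
  have hlt (k : ℕ) : F k / (c k * F (k + 1)) < 1 := by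
    rw [div_lt_one (hden k), hrec]
    exact lt_add_of_pos_right _ (mul_pos (he k) (hF _))
  refine ⟨⟨(hpos 0).le, hlt 0⟩, fun n _ => ⟨hpos n, hlt n⟩, fun n hn => ?_⟩
  obtain ⟨k, rfl⟩ := Nat.exists_eq_add_of_le' hn
  have hF1 := (hF (k + 1)).ne'
  have hF2 := (hF (k + 2)).ne'
  rw [ha, Nat.add_sub_cancel, one_sub_div (hden k).ne', hrec, add_sub_cancel_left, ← hrec,
    div_mul_div_comm, ← mul_div_mul_right (e k) (c k * c (k + 1)) (mul_ne_zero hF1 hF2)]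
  congr 1 <;> ring

theorem isMaximalParameterSequence_of_bounded_solution (he0 : ∀ k, 0 < e k) (he1 : ∀ k, e k ≤ 1)
    (hF : ∀ k, 0 < F k) (hbdd : BddAbove (Set.range F))
    (hrec : ∀ k, c k * F (k + 1) = F k + e k * F (k + 2))
    (ha : ∀ k, a (k + 1) = e k / (c k * c (k + 1))) :
    IsMaximalParameterSequence a fun k => F k / (c k * F (k + 1)) := by
  refine (isParameterSequence_of_recurrence he0 hF hrec ha).isMaximal_of_not_summable fun hs => ?_
  have hratio (k : ℕ) : F k / F (k + 2) ≤
      F k / (c k * F (k + 1)) / (1 - F k / (c k * F (k + 1))) := by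
    have hden : 0 < c k * F (k + 1) := hrec k ▸ add_pos (hF k) (mul_pos (he0 k) (hF _))
    rw [one_sub_div hden.ne', div_div_div_cancel_right₀ hden.ne', hrec, add_sub_cancel_left]
    exact div_le_div_of_nonneg_left (hF k).le (mul_pos (he0 k) (hF _))
      (mul_le_of_le_one_left (hF _).le (he1 k))
  set R : ℕ → ℝ := fun n => ∏ k ∈ range n, F (k + 1) / (c (k + 1) * F (k + 2)) /
    (1 - F (k + 1) / (c (k + 1) * F (k + 2)))
  have htelescope (n : ℕ) : F 1 * F 2 / (F (n + 1) * F (n + 2)) ≤ R n := by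
    have hprod : ∏ k ∈ range n, F (k + 1) / F (k + 3) = F 1 * F 2 / (F (n + 1) * F (n + 2)) := by
      refine prod_range_induction _ (fun n => F 1 * F 2 / (F (n + 1) * F (n + 2)))
        (div_self (mul_pos (hF 1) (hF 2)).ne') n fun k _ => ?_
      have hF2 := (hF (k + 2)).ne'
      have hF1 := (hF (k + 1)).ne'
      field_simp
    rw [← hprod]
    exact prod_le_prod (fun k _ => (div_pos (hF _) (hF _)).le) fun k _ => hratio (k + 1)
  obtain ⟨K, hK⟩ := hbdd
  have hFK (k : ℕ) : F k ≤ K := hK ⟨k, rfl⟩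
  have hK0 : 0 < K := (hF 0).trans_le (hFK 0)
  have hlower (n : ℕ) : F 1 * F 2 / (K * K) ≤ R n := by
    refine le_trans ?_ (htelescope n)
    have hF1 := hF 1
    have hF2 := hF 2
    have hFn1 := hF (n + 1)
    have hFn2 := hF (n + 2)
    gcongr <;> exact hFK _
  exact (div_pos (mul_pos (hF 1) (hF 2)) (mul_pos hK0 hK0)).not_ge
    (ge_of_tendsto' hs.tendsto_atTop_zero hlower)

end ChainSequence

section MaxParameter

variable {q : ℝ} {β : ℂ}

/-- The maximal parameter sequence in closed form: for `β = q ^ b`, `‖β‖ = q ^ λ` and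
`β.re = q ^ λ cos η_q`, so that `maxParameter q β k` is `M_{k+1}^{(b)}`. -/
noncomputable def maxParameter (q : ℝ) (β : ℂ) (k : ℕ) : ℝ :=
  (heineSolution q β (conj β) k).re /
    (2 * (1 - q ^ k * β.re) * (heineSolution q β (conj β) (k + 1)).re)

lemma one_sub_conj_mul_pow_ne_zero (hq0 : 0 ≤ q) (hq1 : q < 1) (hβ : ‖β‖ < 1) (n : ℕ) :
    1 - conj β * (q : ℂ) ^ n ≠ 0 :=
  one_sub_mul_pow_ne_zero (by rw [Complex.norm_of_nonneg hq0]; exact hq1.le)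
    (by rwa [Complex.norm_conj]) n

lemma ofReal_re_heineSolution_conj (hq0 : 0 ≤ q) (hq1 : q < 1) (hβ0 : β ≠ 0) (hβ : ‖β‖ < 1)
    (k : ℕ) :
    ((heineSolution q β (conj β) k).re : ℂ) = heineSolution q β (conj β) k :=
  (Complex.eq_re_of_ofReal_le (heineSolution_conj_pos hq0 hq1 hβ0 hβ k).le).symm

lemma re_heineSolution_conj_recurrence (hq0 : 0 ≤ q) (hq1 : q < 1) (hβ0 : β ≠ 0) (hβ : ‖β‖ < 1)
    (k : ℕ) :
    2 * (1 - q ^ k * β.re) * (heineSolution q β (conj β) (k + 1)).re =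
      (heineSolution q β (conj β) k).re + (1 - q ^ (k + 1)) * (1 - q ^ k * ‖β‖ ^ 2) *
        (heineSolution q β (conj β) (k + 2)).re := by
  have hq : ‖(q : ℂ)‖ < 1 := by rwa [Complex.norm_of_nonneg hq0]
  have hrec := heineSolution_recurrence hq hβ0 hβ (one_sub_conj_mul_pow_ne_zero hq0 hq1 hβ) k
  rw [Complex.add_conj, Complex.mul_conj'] at hrec
  apply Complex.ofReal_injective
  push_cast at hrec ⊢
  simp only [ofReal_re_heineSolution_conj hq0 hq1 hβ0 hβ]
  linear_combination hrec

lemma tendsto_re_heineSolution_conj (hq0 : 0 ≤ q) (hq1 : q < 1) (hβ0 : β ≠ 0) (hβ : ‖β‖ < 1) :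
    Tendsto (fun k => (heineSolution q β (conj β) k).re) atTop (𝓝 (qPochInf q q).re) := by
  have hq : ‖(q : ℂ)‖ < 1 := by rwa [Complex.norm_of_nonneg hq0]
  exact (Complex.continuous_re.tendsto _).comp
    (tendsto_heineSolution hq hβ0 hβ (one_sub_conj_mul_pow_ne_zero hq0 hq1 hβ))

theorem isMaximalParameterSequence_maxParameter {a : ℕ → ℝ} (hq0 : 0 ≤ q) (hq1 : q < 1)
    (hβ0 : β ≠ 0) (hβ : ‖β‖ < 1)
    (ha : ∀ k, a (k + 1) = (1 - q ^ (k + 1)) * (1 - q ^ k * ‖β‖ ^ 2) /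
      (2 * (1 - q ^ k * β.re) * (2 * (1 - q ^ (k + 1) * β.re)))) :
    IsMaximalParameterSequence a (maxParameter q β) := by
  have hpow (k : ℕ) : 0 ≤ q ^ k := pow_nonneg hq0 k
  have hsq : ‖β‖ ^ 2 < 1 := pow_lt_one₀ (norm_nonneg _) hβ two_ne_zero
  have hleft (k : ℕ) : 0 < 1 - q ^ (k + 1) := sub_pos.mpr (pow_lt_one₀ hq0 hq1 k.succ_ne_zero)
  have hright (k : ℕ) : 0 < 1 - q ^ k * ‖β‖ ^ 2 := sub_pos.mpr
    (mul_lt_one_of_nonneg_of_lt_one_right (pow_le_one₀ hq0 hq1.le) (sq_nonneg _) hsq)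
  exact isMaximalParameterSequence_of_bounded_solution
    (e := fun k => (1 - q ^ (k + 1)) * (1 - q ^ k * ‖β‖ ^ 2))
    (fun k => mul_pos (hleft k) (hright k))
    (fun k => mul_le_one₀ (sub_le_self _ (hpow _)) (hright k).le
      (sub_le_self _ (mul_nonneg (hpow k) (sq_nonneg _))))
    (fun k => (Complex.pos_iff.mp (heineSolution_conj_pos hq0 hq1 hβ0 hβ k)).1)
    (tendsto_re_heineSolution_conj hq0 hq1 hβ0 hβ).bddAbove_range
    (re_heineSolution_conj_recurrence hq0 hq1 hβ0 hβ) ha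

theorem tendsto_maxParameter (hq0 : 0 ≤ q) (hq1 : q < 1) (hβ0 : β ≠ 0) (hβ : ‖β‖ < 1) :
    Tendsto (maxParameter q β) atTop (𝓝 (1 / 2)) := by
  have hlim := tendsto_re_heineSolution_conj hq0 hq1 hβ0 hβ
  have hl : (qPochInf q q).re ≠ 0 :=
    (Complex.pos_iff.mp (qPochInf_ofReal_pos hq0 hq1 hq0 hq1)).1.ne'
  have hc : Tendsto (fun k : ℕ => 2 * (1 - q ^ k * β.re)) atTop (𝓝 2) := by
    simpa using (((tendsto_pow_atTop_nhds_zero_of_lt_one hq0 hq1).mul_const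
      β.re).const_sub 1).const_mul 2
  have hquot := hlim.div (hc.mul (hlim.comp (tendsto_add_atTop_nat 1)))
    (mul_ne_zero two_ne_zero hl)
  rwa [div_mul_cancel_right₀ hl, ← one_div] at hquot

theorem ofReal_maxParameter (hq0 : 0 ≤ q) (hq1 : q < 1) (hβ0 : β ≠ 0) (hβ : ‖β‖ < 1) (k : ℕ) :
    (maxParameter q β k : ℂ) =
      1 / 2 * ((1 - conj β * (q : ℂ) ^ k) / (1 - (q ^ k * β.re : ℝ))) *
        (phi21 ((q : ℂ) ^ k) (q / β) (conj β * (q : ℂ) ^ k) q β /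
          phi21 ((q : ℂ) ^ (k + 1)) (q / β) (conj β * (q : ℂ) ^ (k + 1)) q β) := by
  have hq : ‖(q : ℂ)‖ < 1 := by rwa [Complex.norm_of_nonneg hq0]
  have hratio := heineSolution_div_succ hq hβ (one_sub_conj_mul_pow_ne_zero hq0 hq1 hβ) k
  rw [maxParameter]
  push_cast
  simp only [ofReal_re_heineSolution_conj hq0 hq1 hβ0 hβ]
  rw [div_mul_eq_div_div_swap, hratio]
  generalize 1 - (q : ℂ) ^ k * β.re = c
  ring

lemma summable_phiTerm_conj (hq0 : 0 ≤ q) (hq1 : q < 1) (hβ : ‖β‖ < 1) (k : ℕ) :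
    Summable (phiTerm ((q : ℂ) ^ k) (q / β) (conj β * (q : ℂ) ^ k) q β) := by
  refine summable_phiTerm (by rwa [Complex.norm_of_nonneg hq0]) _ _ (fun n => ?_) hβ
  rw [mul_assoc, ← pow_add]
  exact one_sub_conj_mul_pow_ne_zero hq0 hq1 hβ _

lemma phi21_conj_ne_zero (hq0 : 0 ≤ q) (hq1 : q < 1) (hβ0 : β ≠ 0) (hβ : ‖β‖ < 1) (k : ℕ) :
    phi21 ((q : ℂ) ^ k) (q / β) (conj β * (q : ℂ) ^ k) q β ≠ 0 :=
  right_ne_zero_of_mul (right_ne_zero_of_mul (heineSolution_conj_pos hq0 hq1 hβ0 hβ k).ne')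

end MaxParameter

section BaseCpow

variable {q : ℝ}

lemma ofReal_cpow_conj (hq0 : 0 ≤ q) (b : ℂ) : (q : ℂ) ^ conj b = conj ((q : ℂ) ^ b) := by
  have harg : (q : ℂ).arg ≠ Real.pi := by
    rw [Complex.arg_ofReal_of_nonneg hq0]; exact Real.pi_pos.ne
  rw [Complex.cpow_conj _ _ harg, Complex.conj_ofReal]

lemma ofReal_cpow_conj_add_natCast (hq0 : 0 < q) (b : ℂ) (k : ℕ) :
    (q : ℂ) ^ (conj b + (k : ℂ)) = conj ((q : ℂ) ^ b) * (q : ℂ) ^ k := by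
  rw [Complex.cpow_add _ _ (Complex.ofReal_ne_zero.mpr hq0.ne'), Complex.cpow_natCast,
    ofReal_cpow_conj hq0.le]

lemma ofReal_cpow_neg_add_one (hq0 : 0 < q) (b : ℂ) : (q : ℂ) ^ (-b + 1) = q / (q : ℂ) ^ b := by
  rw [Complex.cpow_add _ _ (Complex.ofReal_ne_zero.mpr hq0.ne'), Complex.cpow_one,
    Complex.cpow_neg, inv_mul_eq_div]

lemma phiBTerm_eq_phiTerm (hq0 : 0 < q) (b : ℂ) (k : ℕ) :
    phiBTerm q b k = phiTerm ((q : ℂ) ^ k) (q / (q : ℂ) ^ b) (conj ((q : ℂ) ^ b) * (q : ℂ) ^ k) q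
      ((q : ℂ) ^ b) := by
  rw [← ofReal_cpow_conj_add_natCast hq0, ← ofReal_cpow_neg_add_one hq0]
  rfl

lemma phiB_eq_phi21 (hq0 : 0 < q) (b : ℂ) (k : ℕ) :
    phiB q b k = phi21 ((q : ℂ) ^ k) (q / (q : ℂ) ^ b) (conj ((q : ℂ) ^ b) * (q : ℂ) ^ k) q
      ((q : ℂ) ^ b) := by
  rw [phiB, ofReal_cpow_conj_add_natCast hq0, ofReal_cpow_neg_add_one hq0]

lemma norm_ofReal_cpow_sub_I_mul (hq0 : 0 < q) (lam eta : ℝ) :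
    ‖(q : ℂ) ^ ((lam : ℂ) - Complex.I * (eta : ℂ))‖ = q ^ lam := by
  rw [Complex.norm_cpow_eq_rpow_re_of_pos hq0]
  simp

lemma re_ofReal_cpow_sub_I_mul (hq0 : 0 < q) (lam eta : ℝ) :
    ((q : ℂ) ^ ((lam : ℂ) - Complex.I * (eta : ℂ))).re =
      q ^ lam * Real.cos (eta * Real.log q) := by
  rw [Complex.cpow_def_of_ne_zero (Complex.ofReal_ne_zero.mpr hq0.ne'), ← Complex.ofReal_log hq0.le,
    Complex.exp_re, Real.rpow_def_of_pos hq0]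
  simp [mul_comm]

lemma dSeq_succ (hq0 : 0 < q) (lam eta : ℝ) (k : ℕ) :
    dSeq q lam eta (k + 1) = (1 - q ^ (k + 1)) * (1 - q ^ k * (q ^ lam) ^ 2) /
      (2 * (1 - q ^ k * (q ^ lam * Real.cos (eta * Real.log q))) *
        (2 * (1 - q ^ (k + 1) * (q ^ lam * Real.cos (eta * Real.log q))))) := by
  have hnum : q ^ (2 * lam + ((k + 1 : ℕ) : ℝ) - 1) = q ^ k * (q ^ lam) ^ 2 := by
    rw [show 2 * lam + ((k + 1 : ℕ) : ℝ) - 1 = lam * (2 : ℕ) + k by push_cast; ring,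
      Real.rpow_add hq0, Real.rpow_natCast, Real.rpow_mul hq0.le, Real.rpow_natCast, mul_comm]
  have hleft : q ^ (lam + ((k + 1 : ℕ) : ℝ) - 1) = q ^ k * q ^ lam := by
    rw [show lam + ((k + 1 : ℕ) : ℝ) - 1 = lam + k by push_cast; ring,
      Real.rpow_add hq0, Real.rpow_natCast, mul_comm]
  have hright : q ^ (lam + ((k + 1 : ℕ) : ℝ)) = q ^ (k + 1) * q ^ lam := by
    rw [Real.rpow_add hq0, Real.rpow_natCast, mul_comm]
  rw [dSeq, hnum, hleft, hright]
  congr 1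
  ring

end BaseCpow

theorem theorem5p2 (q lam eta : ℝ) (b : ℂ) (hq0 : 0 < q) (hq1 : q < 1) (hlam : 0 < lam)
    (hb : b = (lam : ℂ) - Complex.I * (eta : ℂ)) :
    IsPositiveChainSequence (dSeq q lam eta) ∧
    (∃ M : ℕ → ℝ, IsMaximalParameterSequence (dSeq q lam eta) M) ∧
    (∀ k : ℕ, Summable (phiBTerm q b k) ∧ phiB q b (k + 1) ≠ 0) ∧
    ∀ M : ℕ → ℝ, IsMaximalParameterSequence (dSeq q lam eta) M →
      (∀ k : ℕ, (M k : ℂ) =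
        1 / 2 * ((1 - (q : ℂ) ^ ((starRingEnd ℂ) b + (k : ℂ))) /
          (1 - ((q ^ (lam + (k : ℝ)) * Real.cos (eta * Real.log q) : ℝ) : ℂ))) *
          (phiB q b k / phiB q b (k + 1))) ∧
      Filter.Tendsto M Filter.atTop (nhds (1 / 2)) := by
  have hβre : ((q : ℂ) ^ b).re = q ^ lam * Real.cos (eta * Real.log q) := by
    rw [hb, re_ofReal_cpow_sub_I_mul hq0]
  have hβnorm : ‖(q : ℂ) ^ b‖ = q ^ lam := by rw [hb, norm_ofReal_cpow_sub_I_mul hq0]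
  have hβ : ‖(q : ℂ) ^ b‖ < 1 := hβnorm ▸ Real.rpow_lt_one hq0.le hq1 hlam
  have hβ0 : (q : ℂ) ^ b ≠ 0 := norm_pos_iff.mp (hβnorm ▸ Real.rpow_pos_of_pos hq0 lam)
  have hmax : IsMaximalParameterSequence (dSeq q lam eta) (maxParameter q ((q : ℂ) ^ b)) :=
    isMaximalParameterSequence_maxParameter hq0.le hq1 hβ0 hβ fun k => by
      rw [dSeq_succ hq0, hβnorm, hβre]
  refine ⟨⟨_, hmax.1⟩, ⟨_, hmax⟩, fun k => ⟨?_, ?_⟩, fun M hM => ?_⟩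
  · rw [phiBTerm_eq_phiTerm hq0]
    exact summable_phiTerm_conj hq0.le hq1 hβ k
  · rw [phiB_eq_phi21 hq0]
    exact phi21_conj_ne_zero hq0.le hq1 hβ0 hβ _
  · obtain rfl := hM.unique hmax
    refine ⟨fun k => ?_, tendsto_maxParameter hq0.le hq1 hβ0 hβ⟩
    have hden : q ^ (lam + (k : ℝ)) * Real.cos (eta * Real.log q) = q ^ k * ((q : ℂ) ^ b).re := by
      rw [hβre, Real.rpow_add_natCast hq0.ne']
      ring
    rw [ofReal_maxParameter hq0.le hq1 hβ0 hβ, phiB_eq_phi21 hq0, phiB_eq_phi21 hq0,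
      ofReal_cpow_conj_add_natCast hq0, hden]
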